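/- Let $X$ be a geodesic metric space which is $\delta$-hyperbolic in the sense of Gromov, and let $\mathcal{Y} = \{Y_i\}_{i \in I}$ be a family of uniformly quasiconvex subsets of $X$: there is a constant $Q$ such that, for every $i$, every geodesic of $X$ with both endpoints in $Y_i$ lies in the $Q$-neighbourhood of $Y_i$. The electrification $X_{\mathcal{Y}}$ is the metric space obtained from $X$ by adding a cone vertex $y_i$ for each (nonempty) $Y_i$ and attaching an edge of length $1/2$ from each $y \in Y_i$ to $y_i$, with the induced gluing metric. Let $f$ and $g$ be isometries of $X$, each of which permutes the family $\mathcal{Y}$ (that is, $f(Y_i) = Y_{\sigma(i)}$ and $g(Y_i) = Y_{\tau(i)}$ for permutations $\sigma, \tau$ of $I$), so that $f$ and $g$ also act by isometries on $X_{\mathcal{Y}}$. An isometry $h$ of a space is loxodromic if its translation length $\lim_{n\to\infty} \frac1n d(x_0, h^n x_0)$ is positive; two loxodromic isometries are independent if their sets of fixed points in the Gromov boundary of the space are disjoint. Suppose that $f$ and $g$ act loxodromically on $X_{\mathcal{Y}}$, and that they are independent loxodromics as isometries of $X$. Then they are independent loxodromics acting on $X_{\mathcal{Y}}$. -/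

import Mathlib

open Filter Topology

/-! ### Gromov hyperbolic geodesic spaces -/

section Hyperbolic

variable {X : Type*} [MetricSpace X]

/-- The Gromov product `(x | y)_o`. -/
noncomputable def gromovProduct (o x y : X) : ℝ :=
  (dist o x + dist o y - dist x y) / 2

/-- `δ`-hyperbolicity in the sense of Gromov (the four point condition). -/
def IsGromovHyperbolic (X : Type*) [MetricSpace X] (δ : ℝ) : Prop :=
  ∀ o x y z : X,
    min (gromovProduct o x y) (gromovProduct o y z) - δ ≤ gromovProduct o x z

/-- `γ`, restricted to `[0, dist x y]`, is a geodesic from `x` to `y`. -/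
def IsGeodesicFromTo (γ : ℝ → X) (x y : X) : Prop :=
  γ 0 = x ∧ γ (dist x y) = y ∧
    ∀ s ∈ Set.Icc 0 (dist x y), ∀ t ∈ Set.Icc 0 (dist x y), dist (γ s) (γ t) = |s - t|

/-- Any two points are joined by a geodesic. -/
def IsGeodesicSpace (X : Type*) [MetricSpace X] : Prop :=
  ∀ x y : X, ∃ γ : ℝ → X, IsGeodesicFromTo γ x y

/-- Every geodesic between two points of `Y` lies in the (closed) `Q`-neighbourhood of `Y`. -/
def IsQuasiconvex (Q : ℝ) (Y : Set X) : Prop :=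
  ∀ x ∈ Y, ∀ y ∈ Y, ∀ γ : ℝ → X, IsGeodesicFromTo γ x y →
    ∀ t ∈ Set.Icc 0 (dist x y), ∃ z ∈ Y, dist (γ t) z ≤ Q

/-! ### The Gromov boundary, loxodromic isometries, independence -/

/-- The sequences `u`, `v` satisfy `(u_m | v_n)_o → ∞` as `m, n → ∞`
(for one, equivalently every, base point `o`). -/
def GromovAsymptotic (u v : ℕ → X) : Prop :=
  ∀ o : X, Tendsto (fun p : ℕ × ℕ => gromovProduct o (u p.1) (v p.2)) atTop atTop

/-- The Gromov boundary: sequences converging to infinity, that is with `(u_m | u_n)_o → ∞`,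
where `u` and `v` are identified when `(u_m | v_n)_o → ∞`. On a hyperbolic space
that relation is already an equivalence relation. -/
def GromovBoundary (X : Type*) [MetricSpace X] : Type _ :=
  Quot (fun u v : {u : ℕ → X // GromovAsymptotic u u} => GromovAsymptotic u.1 v.1)

theorem gromovProduct_isometry (f : X ≃ᵢ X) (o x y : X) :
    gromovProduct o (f x) (f y) = gromovProduct (f.symm o) x y := by
  have h : ∀ z, dist o (f z) = dist (f.symm o) z := fun z => by
    rw [← f.dist_eq (f.symm o) z, f.apply_symm_apply]
  simp only [gromovProduct, h, f.dist_eq]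

theorem GromovAsymptotic.map (f : X ≃ᵢ X) {u v : ℕ → X} (h : GromovAsymptotic u v) :
    GromovAsymptotic (fun n => f (u n)) (fun n => f (v n)) := by
  intro o
  simp only [gromovProduct_isometry]
  exact h (f.symm o)

/-- The action of an isometry on the Gromov boundary. -/
def boundaryMap (f : X ≃ᵢ X) : GromovBoundary X → GromovBoundary X :=
  Quot.map (fun u => ⟨fun n => f (u.1 n), u.2.map f⟩) (fun _ _ h => h.map f)

/-- `f` is loxodromic: its translation length `lim d(x₀, fⁿ x₀) / n` is positive. The limit
always exists and does not depend on the base point `x₀`. -/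
def IsLoxodromic (f : X ≃ᵢ X) : Prop :=
  ∃ x₀ : X, ∃ τ : ℝ, 0 < τ ∧
    Tendsto (fun n : ℕ => dist x₀ ((f ^ n) x₀) / (n : ℝ)) atTop (𝓝 τ)

/-- `f` and `g` are loxodromic and have no common fixed point in the Gromov boundary. -/
def AreIndependentLoxodromics (f g : X ≃ᵢ X) : Prop :=
  IsLoxodromic f ∧ IsLoxodromic g ∧
    Disjoint (Function.fixedPoints (boundaryMap f)) (Function.fixedPoints (boundaryMap g))

end Hyperbolic

/-! ### The electrification of a metric space along a family of subsets -/

section Electrification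

variable {X : Type*} [MetricSpace X] {ι : Type*}

/-- The disjoint union of `X` and of one segment `[0, 1/2]` for each `i` and each `y ∈ Y i`. -/
inductive PreElectrification (Y : ι → Set X)
  | base (x : X) : PreElectrification Y
  | edge (i : ι) (y : Y i) (t : Set.Icc (0 : ℝ) (1 / 2)) : PreElectrification Y

namespace PreElectrification

variable {Y : ι → Set X}

/-- Elementary moves and their lengths: moves inside `X`, moves inside a segment, and moves of
length zero between points that are glued. The end `0` of the segment of `y ∈ Y i` is glued to `y`,
and the ends `1/2` of all the segments of `Y i` are glued together, to form the cone vertex of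
`Y i`. -/
inductive Step : PreElectrification Y → PreElectrification Y → ℝ → Prop
  | base (x x' : X) : Step (base x) (base x') (dist x x')
  | edge (i : ι) (y : Y i) (s t : Set.Icc (0 : ℝ) (1 / 2)) :
      Step (edge i y s) (edge i y t) |(s : ℝ) - t|
  | down (i : ι) (y : Y i) : Step (edge i y ⟨0, by norm_num⟩) (base y) 0
  | up (i : ι) (y : Y i) : Step (base y) (edge i y ⟨0, by norm_num⟩) 0
  | apex (i : ι) (y y' : Y i) :
      Step (edge i y ⟨1 / 2, by norm_num⟩) (edge i y' ⟨1 / 2, by norm_num⟩) 0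

/-- `Chain p q a`: some finite chain of elementary moves from `p` to `q` has total length `a`. -/
inductive Chain : PreElectrification Y → PreElectrification Y → ℝ → Prop
  | nil (p : PreElectrification Y) : Chain p p 0
  | cons {p q r : PreElectrification Y} {a b : ℝ} :
      Step p q a → Chain q r b → Chain p r (a + b)

theorem Step.nonneg {p q : PreElectrification Y} {a : ℝ} (h : Step p q a) : 0 ≤ a := by
  cases h <;> first | exact dist_nonneg | exact abs_nonneg _ | exact le_rfl

theorem Step.symm {p q : PreElectrification Y} {a : ℝ} (h : Step p q a) : Step q p a := by
  cases h with
  | base x x' => rw [dist_comm]; exact .base _ _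
  | edge i y s t => rw [abs_sub_comm]; exact .edge _ _ _ _
  | down i y => exact .up _ _
  | up i y => exact .down _ _
  | apex i y y' => exact .apex _ _ _

theorem Chain.nonneg {p q : PreElectrification Y} {a : ℝ} (h : Chain p q a) : 0 ≤ a := by
  induction h with
  | nil => exact le_rfl
  | cons h _ ih => exact add_nonneg h.nonneg ih

theorem Chain.trans {p q r : PreElectrification Y} {a b : ℝ} (h : Chain p q a)
    (h' : Chain q r b) : Chain p r (a + b) := by
  induction h with
  | nil => simpa using h'
  | cons s _ ih => rw [add_assoc]; exact .cons s (ih h')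

theorem Step.chain {p q : PreElectrification Y} {a : ℝ} (h : Step p q a) : Chain p q a := by
  simpa using Chain.cons h (.nil q)

theorem Chain.symm {p q : PreElectrification Y} {a : ℝ} (h : Chain p q a) : Chain q p a := by
  induction h with
  | nil => exact .nil _
  | cons s _ ih => rw [add_comm]; exact ih.trans s.symm.chain

theorem Chain.to_base (p : PreElectrification Y) : ∃ (x : X) (a : ℝ), Chain p (.base x) a := by
  cases p with
  | base x => exact ⟨x, 0, .nil _⟩
  | edge i y t =>
    exact ⟨y, _, (Step.edge i y t ⟨0, by norm_num⟩).chain.trans (Step.down i y).chain⟩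

theorem Chain.exists (p q : PreElectrification Y) : ∃ a : ℝ, Chain p q a := by
  obtain ⟨x, a, hx⟩ := Chain.to_base p
  obtain ⟨y, b, hy⟩ := Chain.to_base q
  exact ⟨_, (hx.trans (Step.base x y).chain).trans hy.symm⟩

/-- The gluing (pseudo)distance: the infimum of the lengths of the chains from `p` to `q`. -/
noncomputable def chainDist (p q : PreElectrification Y) : ℝ := sInf {a | Chain p q a}

theorem bddBelow_chain (p q : PreElectrification Y) : BddBelow {a | Chain p q a} :=
  ⟨0, fun _ h => h.nonneg⟩

noncomputable instance : PseudoMetricSpace (PreElectrification Y) where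
  dist := chainDist
  dist_self p := le_antisymm (csInf_le (bddBelow_chain p p) (.nil p))
    (Real.sInf_nonneg fun _ h => h.nonneg)
  dist_comm p q := congrArg sInf (Set.ext fun _ => ⟨Chain.symm, Chain.symm⟩)
  dist_triangle p q r := by
    refine le_of_forall_pos_le_add fun ε hε => ?_
    obtain ⟨a, ha, ha'⟩ := Real.lt_sInf_add_pos (Chain.exists p q) (half_pos hε)
    obtain ⟨b, hb, hb'⟩ := Real.lt_sInf_add_pos (Chain.exists q r) (half_pos hε)
    have h : chainDist p r ≤ a + b := csInf_le (bddBelow_chain p r) (ha.trans hb)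
    change chainDist p r ≤ chainDist p q + chainDist q r + ε
    have e₁ : chainDist p q = sInf {a | Chain p q a} := rfl
    have e₂ : chainDist q r = sInf {a | Chain q r a} := rfl
    replace ha' : a < sInf {a | Chain p q a} + ε / 2 := ha'
    replace hb' : b < sInf {a | Chain q r a} + ε / 2 := hb'
    linarith

/-- The map of glued pieces induced by a self-map of `X` and a compatible map of the indices. -/
def map (f : X → X) (σ : ι → ι) (h : ∀ i, Set.MapsTo f (Y i) (Y (σ i))) :
    PreElectrification Y → PreElectrification Y
  | base x => base (f x)
  | edge i y t => edge (σ i) ⟨f y, h i y.2⟩ t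

theorem Chain.map {f : X → X} {σ : ι → ι} (hf : Isometry f)
    (h : ∀ i, Set.MapsTo f (Y i) (Y (σ i))) {p q : PreElectrification Y} {a : ℝ}
    (c : Chain p q a) : Chain (p.map f σ h) (q.map f σ h) a := by
  induction c with
  | nil => exact .nil _
  | cons s _ ih =>
    refine .cons ?_ ih
    cases s with
    | base x x' => rw [← hf.dist_eq]; exact .base _ _
    | edge i y s t => exact .edge _ _ _ _
    | down i y => exact .down _ (⟨f y, h i y.2⟩ : Y (σ i))
    | up i y => exact .up _ (⟨f y, h i y.2⟩ : Y (σ i))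
    | apex i y y' => exact .apex _ _ _

theorem dist_map_le {f : X → X} {σ : ι → ι} (hf : Isometry f)
    (h : ∀ i, Set.MapsTo f (Y i) (Y (σ i))) (p q : PreElectrification Y) :
    dist (p.map f σ h) (q.map f σ h) ≤ dist p q :=
  csInf_le_csInf (bddBelow_chain _ _) (Chain.exists p q) fun _ c => c.map hf h

set_option linter.unusedSectionVars false in
theorem map_map {f f' : X → X} {σ σ' : ι → ι} (h : ∀ i, Set.MapsTo f (Y i) (Y (σ i)))
    (h' : ∀ i, Set.MapsTo f' (Y i) (Y (σ' i))) (hf : ∀ x, f' (f x) = x)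
    (hσ : ∀ i, σ' (σ i) = i) (p : PreElectrification Y) : (p.map f σ h).map f' σ' h' = p := by
  cases p with
  | base x => simp [map, hf]
  | edge i y t =>
    have key : ∀ (j : ι) (z : X) (hz : z ∈ Y j), j = i → z = y →
        (edge j ⟨z, hz⟩ t : PreElectrification Y) = edge i y t := by
      rintro j z hz rfl rfl
      rfl
    exact key _ _ _ (hσ i) (hf y)

end PreElectrification

/-- The electrification `X_𝒴` of `X` along `𝒴 = {Y i}`: a cone vertex is added for each (nonempty)
`Y i`, and each `y ∈ Y i` is joined to it by an edge of length `1/2`. -/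
abbrev Electrification (Y : ι → Set X) : Type _ := SeparationQuotient (PreElectrification Y)

theorem mapsTo_symm_of_image_eq {Y : ι → Set X} (f : X ≃ᵢ X) (σ : Equiv.Perm ι)
    (h : ∀ i, f '' Y i = Y (σ i)) (i : ι) : Set.MapsTo f.symm (Y i) (Y (σ.symm i)) := by
  intro y hy
  rw [← σ.apply_symm_apply i, ← h] at hy
  obtain ⟨z, hz, rfl⟩ := hy
  simpa using hz

/-- The isometry of `X_𝒴` induced by an isometry `f` of `X` which permutes the family `𝒴`,
with `f (Y i) = Y (σ i)`: it is `f` on `X` and sends, for `y ∈ Y i`, the edge from `y` to the cone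
vertex of `Y i` isometrically to the edge from `f y` to the cone vertex of `Y (σ i)`. -/
noncomputable def electrificationIsometry {Y : ι → Set X} (f : X ≃ᵢ X) (σ : Equiv.Perm ι)
    (h : ∀ i, f '' Y i = Y (σ i)) : Electrification Y ≃ᵢ Electrification Y :=
  have h₁ : ∀ i, Set.MapsTo f (Y i) (Y (σ i)) := fun i => Set.mapsTo_iff_image_subset.2 (h i).subset
  have h₂ := mapsTo_symm_of_image_eq f σ h
  have e₁ : ∀ p : PreElectrification Y, (p.map f σ h₁).map f.symm σ.symm h₂ = p :=
    PreElectrification.map_map h₁ h₂ f.symm_apply_apply σ.symm_apply_apply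
  have e₂ : ∀ p : PreElectrification Y, (p.map f.symm σ.symm h₂).map f σ h₁ = p :=
    PreElectrification.map_map h₂ h₁ f.apply_symm_apply σ.apply_symm_apply
  have d₁ : ∀ p q : PreElectrification Y, dist (p.map f σ h₁) (q.map f σ h₁) = dist p q :=
    fun p q => le_antisymm (PreElectrification.dist_map_le f.isometry h₁ p q) (by
      have := PreElectrification.dist_map_le f.symm.isometry h₂ (p.map f σ h₁) (q.map f σ h₁)
      rwa [e₁, e₁] at this)
  have d₂ : ∀ p q : PreElectrification Y,
      dist (p.map f.symm σ.symm h₂) (q.map f.symm σ.symm h₂) = dist p q := fun p q => by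
    rw [← d₁, e₂, e₂]
  { toFun := SeparationQuotient.lift
      (fun p => SeparationQuotient.mk (p.map f σ h₁)) fun p q hpq => by
        rw [SeparationQuotient.mk_eq_mk, Metric.inseparable_iff, d₁]
        exact Metric.inseparable_iff.1 hpq
    invFun := SeparationQuotient.lift
      (fun p => SeparationQuotient.mk (p.map f.symm σ.symm h₂)) fun p q hpq => by
        rw [SeparationQuotient.mk_eq_mk, Metric.inseparable_iff, d₂]
        exact Metric.inseparable_iff.1 hpq
    left_inv := SeparationQuotient.surjective_mk.forall.2 fun p =>
      congrArg SeparationQuotient.mk (e₁ p)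
    right_inv := SeparationQuotient.surjective_mk.forall.2 fun p =>
      congrArg SeparationQuotient.mk (e₂ p)
    isometry_toFun := Isometry.of_dist_eq <| SeparationQuotient.surjective_mk.forall₂.2 d₁ }

end Electrification

/-! The inclusion of X in its electrification gives an equivariant map of boundaries in the reverse
direction, from the boundary of the electrification to that of X. A common fixed point of f and g in
the former thus has as image a common fixed point in the latter. Neither injectivity of this map nor
hyperbolicity of the electrification is needed.

The map exists because the Gromov product of the electrification is at most that of X plus a
constant (`exists_gromovProduct_le`). This follows once geodesics of X almost satisfy equality in
the triangle inequality for the electrified metric, which comes from a Morse-type argument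
(`exists_dist_path_le`). Suppose a geodesic strays a distance D from a nearly shortest electrified
path. Around its farthest point γ r, a detour through that path has O(D) small steps and stays at
electrified distance about D from γ r. By quasiconvexity each step has Gromov product at γ r at
least D - O(1), and chaining the steps costs only O(log D). But the detour joins two points of the
geodesic on either side of γ r, whose product there is 0; so D is bounded. -/

section Hyperbolic

variable {X : Type*} [MetricSpace X]

/-! ### Gromov products, chains and geodesics in hyperbolic spaces. -/

theorem gromovProduct_comm (o x y : X) : gromovProduct o x y = gromovProduct o y x := by
  simp only [gromovProduct, dist_comm x y, add_comm (dist o x)]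

theorem gromovProduct_self (o x : X) : gromovProduct o x x = dist o x := by
  simp [gromovProduct]

theorem IsGromovHyperbolic.nonneg {δ : ℝ} (hδ : IsGromovHyperbolic X δ) (x : X) : 0 ≤ δ := by
  have := hδ x x x x
  simp only [min_self] at this
  linarith

/-- The Gromov product of the ends of a chain of `n ≤ 2 ^ k` points. -/
theorem IsGromovHyperbolic.le_gromovProduct_chain {δ : ℝ} (hδ : IsGromovHyperbolic X δ)
    (o : X) (m : ℝ) (k : ℕ) : ∀ (u : ℕ → X) (n : ℕ), 0 < n → n ≤ 2 ^ k →
      (∀ i < n, m ≤ gromovProduct o (u i) (u (i + 1))) →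
      m - k * δ ≤ gromovProduct o (u 0) (u n) := by
  have h0 := hδ.nonneg o
  induction k with
  | zero =>
    intro u n hn hn' h
    obtain rfl : n = 1 := by simp at hn'; omega
    simpa using h 0 (by norm_num)
  | succ k ih =>
    intro u n hn hn' h
    rw [pow_succ] at hn'
    rcases Nat.lt_or_ge 1 n with h1 | h1
    -- Each half has at most `2 ^ k` steps, and joining them costs a single `δ`.
    · have a1 := ih u (n / 2) (by omega) (by omega) fun i hi => h i (by omega)
      have a2 := ih (fun i => u (n / 2 + i)) (n - n / 2) (by omega) (by omega)
        fun i hi => h (n / 2 + i) (by omega)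
      have e : n / 2 + (n - n / 2) = n := by omega
      simp only [add_zero, e] at a2
      have := hδ o (u 0) (u (n / 2)) (u n)
      have := le_min a1 a2
      push_cast
      linarith
    · obtain rfl : n = 1 := by omega
      have := h 0 (by norm_num)
      have : 0 ≤ ((k + 1 : ℕ) : ℝ) * δ := by positivity
      simp only [zero_add] at *
      linarith

/-- The distance to a geodesic is at most the Gromov product of its ends, up to `2 * δ`. -/
theorem IsGromovHyperbolic.exists_dist_geodesic_le {δ : ℝ} (hδ : IsGromovHyperbolic X δ)
    {γ : ℝ → X} {a b : X} (hγ : IsGeodesicFromTo γ a b) (p : X) :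
    ∃ t ∈ Set.Icc 0 (dist a b), dist p (γ t) ≤ gromovProduct p a b + 2 * δ := by
  obtain ⟨h0, h1, h⟩ := hγ
  have i1 := dist_triangle a p b
  have i2 := dist_triangle p a b
  have i3 := dist_triangle_right a b p
  have i4 := dist_triangle a b p
  simp only [dist_comm a p, dist_comm b p] at *
  -- This parameter is the product `(p | b)_a`; there the products at `p` of `γ t` with `a` and with
  -- `b` coincide, so the minimum is explicit.
  have ht : (dist p a + dist a b - dist p b) / 2 ∈ Set.Icc 0 (dist a b) := by
    constructor <;> linarith
  refine ⟨_, ht, ?_⟩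
  have e0 := h 0 ⟨le_rfl, dist_nonneg⟩ _ ht
  have e1 := h _ ht (dist a b) ⟨dist_nonneg, le_rfl⟩
  rw [h0, zero_sub, abs_neg, abs_of_nonneg ht.1] at e0
  rw [h1, abs_sub_comm, abs_of_nonneg (sub_nonneg.2 ht.2)] at e1
  have := hδ p a (γ ((dist p a + dist a b - dist p b) / 2)) b
  simp only [gromovProduct, e0, e1] at *
  rw [min_eq_left (by linarith)] at this
  linarith

theorem IsGeodesicFromTo.gromovProduct_eq_zero {γ : ℝ → X} {x y : X}
    (hγ : IsGeodesicFromTo γ x y) {r s t : ℝ} (hr : r ∈ Set.Icc 0 (dist x y))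
    (hs : s ∈ Set.Icc 0 r) (ht : t ∈ Set.Icc r (dist x y)) :
    gromovProduct (γ r) (γ s) (γ t) = 0 := by
  have hs' : s ∈ Set.Icc 0 (dist x y) := ⟨hs.1, hs.2.trans hr.2⟩
  have ht' : t ∈ Set.Icc 0 (dist x y) := ⟨hr.1.trans ht.1, ht.2⟩
  rw [gromovProduct, hγ.2.2 _ hr _ hs', hγ.2.2 _ hr _ ht', hγ.2.2 _ hs' _ ht',
    abs_of_nonneg (sub_nonneg.2 hs.2), abs_of_nonpos (sub_nonpos.2 ht.1),
    abs_of_nonpos (sub_nonpos.2 (hs.2.trans ht.1))]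
  ring

end Hyperbolic

/-- A real number bounded by an affine function of its own logarithm is bounded. -/
theorem exists_bound_of_le_add_log (A B a b : ℝ) :
    ∃ D₀ : ℝ, ∀ D : ℝ, (∀ k : ℕ, a * D + b ≤ 2 ^ k → D ≤ A + k * B) →
      0 ≤ a → 0 ≤ B → D ≤ D₀ := by
  have h1 : Tendsto (fun k : ℕ => (k : ℝ) ^ 1 / 2 ^ k) atTop (𝓝 0) :=
    tendsto_pow_const_div_const_pow_of_one_lt 1 (by norm_num)
  have h2 : Tendsto (fun k : ℕ => (k : ℝ) ^ 0 / 2 ^ k) atTop (𝓝 0) :=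
    tendsto_pow_const_div_const_pow_of_one_lt 0 (by norm_num)
  -- The sum is `(a * (A + (k + 1) * B) + b) / 2 ^ k`. Once it is below 1, an exponent `k + 1`
  -- satisfying the hypothesis cannot be minimal.
  have h3 := (h1.const_mul (a * B)).add (h2.const_mul (a * (A + B) + b))
  simp only [mul_zero, add_zero] at h3
  obtain ⟨k₀, hk₀⟩ := eventually_atTop.1 (h3.eventually_lt_const one_pos)
  refine ⟨A + k₀ * B, fun D hD ha hB => ?_⟩
  have hex : ∃ k : ℕ, a * D + b ≤ 2 ^ k := by
    obtain ⟨k, hk⟩ := pow_unbounded_of_one_lt (a * D + b) (one_lt_two : (1 : ℝ) < 2)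
    exact ⟨k, hk.le⟩
  classical
  have hmin := fun m => Nat.find_min (H := hex) (m := m)
  have hsp := hD _ (Nat.find_spec hex)
  rcases le_or_gt (Nat.find hex) k₀ with hle | hlt
  · have : ((Nat.find hex : ℕ) : ℝ) ≤ k₀ := by exact_mod_cast hle
    nlinarith
  · obtain ⟨j, hj⟩ : ∃ j, Nat.find hex = j + 1 := ⟨Nat.find hex - 1, by omega⟩
    have hj1 := hmin j (by omega)
    have hj2 := hk₀ j (by omega)
    have hp : (0 : ℝ) < 2 ^ j := by positivity
    rw [hj] at hsp
    push_cast at hsp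
    have : a * D ≤ a * (A + (j + 1) * B) := mul_le_mul_of_nonneg_left hsp ha
    rw [mul_div_assoc', mul_div_assoc', ← add_div, div_lt_one hp] at hj2
    exact absurd (by nlinarith) hj1

/-! ### Chains and paths of small steps in the glued space. -/

namespace PreElectrification

variable {X : Type*} [MetricSpace X] {ι : Type*} {Y : ι → Set X}

/-- The point of `X` at the foot of the segment containing a point. -/
def foot : PreElectrification Y → X
  | base x => x
  | edge _ y _ => y

/-- The height of a point above `X`. -/
def height : PreElectrification Y → ℝ
  | base _ => 0
  | edge _ _ t => t

theorem dist_le_of_chain {p q : PreElectrification Y} {a : ℝ} (h : Chain p q a) : dist p q ≤ a :=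
  csInf_le (bddBelow_chain p q) h

theorem exists_chain_lt {p q : PreElectrification Y} {a : ℝ} (h : dist p q < a) :
    ∃ b < a, Chain p q b := by
  obtain ⟨b, hb, hb'⟩ := exists_lt_of_csInf_lt (Chain.exists p q) h
  exact ⟨b, hb', hb⟩

theorem dist_base_le (x y : X) : dist (base x : PreElectrification Y) (base y) ≤ dist x y :=
  dist_le_of_chain (Step.base x y).chain

theorem dist_foot_le (p : PreElectrification Y) : dist p (base p.foot) ≤ 1 / 2 := by
  cases p with
  | base x => simp [foot]
  | edge i y t =>
    refine (dist_le_of_chain ((Step.edge i y t ⟨0, by norm_num⟩).chain.trans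
      (Step.down i y).chain)).trans ?_
    simpa [abs_of_nonneg t.2.1] using t.2.2

theorem dist_base_le_one {i : ι} {y z : X} (hy : y ∈ Y i) (hz : z ∈ Y i) :
    dist (base y : PreElectrification Y) (base z) ≤ 1 := by
  refine (dist_le_of_chain (.cons (Step.up i ⟨y, hy⟩)
    (.cons (Step.edge i _ _ ⟨1 / 2, by norm_num⟩) (.cons (Step.apex i _ ⟨z, hz⟩)
      (.cons (Step.edge i _ _ ⟨0, by norm_num⟩) (Step.down i _).chain))))).trans ?_
  norm_num [abs_of_nonneg, abs_of_nonpos]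

/-- Moves inside `X` are cut along geodesics and moves inside a segment along the segment; gluing
moves have length zero, so there is nothing to cut. -/
theorem Chain.split (hgeod : IsGeodesicSpace X) {p q : PreElectrification Y} {a : ℝ}
    (h : Chain p q a) : ∀ s ∈ Set.Icc 0 a, ∃ r, Chain p r s ∧ Chain r q (a - s) := by
  induction h with
  | nil p =>
    rintro s ⟨h0, h1⟩
    obtain rfl := le_antisymm h1 h0
    exact ⟨p, .nil p, by simpa using Chain.nil p⟩
  | @cons p q r a b st ch ih =>
    rintro s ⟨h0, h1⟩
    rcases le_total a s with has | has
    · obtain ⟨t, ht, ht'⟩ := ih (s - a) ⟨by linarith, by linarith⟩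
      refine ⟨t, ?_, ?_⟩
      · simpa using Chain.cons st ht
      · convert ht' using 1
        ring
    · suffices ∃ t, Chain p t s ∧ Chain t q (a - s) by
        obtain ⟨t, ht, ht'⟩ := this
        refine ⟨t, ht, ?_⟩
        convert ht'.trans ch using 1
        ring
      have triv : ∀ {p q : PreElectrification Y} {a : ℝ}, Step p q a → s ≤ a → a = 0 →
          ∃ t, Chain p t s ∧ Chain t q (a - s) := by
        rintro p q a st has rfl
        obtain rfl := le_antisymm has h0
        exact ⟨p, .nil p, by simpa using st.chain⟩
      cases st with
      | base x y =>
        obtain ⟨γ, e0, e1, hγ⟩ := hgeod x y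
        have a1 := hγ 0 ⟨le_rfl, dist_nonneg⟩ s ⟨h0, has⟩
        have a2 := hγ s ⟨h0, has⟩ (dist x y) ⟨dist_nonneg, le_rfl⟩
        rw [e0, zero_sub, abs_neg, abs_of_nonneg h0] at a1
        rw [e1, abs_sub_comm, abs_of_nonneg (sub_nonneg.2 has)] at a2
        refine ⟨base (γ s), ?_, ?_⟩
        · simpa only [a1] using (Step.base (Y := Y) x (γ s)).chain
        · simpa only [a2] using (Step.base (Y := Y) (γ s) y).chain
      | edge i y u v =>
        have hu := u.2
        have hv := v.2
        rcases le_total (u : ℝ) v with huv | huv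
        · have hab : |(u : ℝ) - v| = v - u := by rw [abs_of_nonpos (by linarith)]; ring
          rw [hab] at has ⊢
          let w : Set.Icc (0 : ℝ) (1 / 2) := ⟨u + s, by linarith [hu.1], by linarith [hv.2]⟩
          refine ⟨edge i y w, ?_, ?_⟩
          · convert (Step.edge i y u w).chain using 1
            simp [w, abs_of_nonneg h0]
          · convert (Step.edge i y w v).chain using 1
            simp only [w]
            rw [abs_of_nonpos (by linarith)]
            ring
        · have hab : |(u : ℝ) - v| = u - v := abs_of_nonneg (by linarith)
          rw [hab] at has ⊢
          let w : Set.Icc (0 : ℝ) (1 / 2) := ⟨u - s, by linarith [hv.1], by linarith [hu.2]⟩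
          refine ⟨edge i y w, ?_, ?_⟩
          · convert (Step.edge i y u w).chain using 1
            simp [w, abs_of_nonneg h0]
          · convert (Step.edge i y w v).chain using 1
            simp only [w]
            rw [abs_of_nonneg (by linarith)]
            ring
      | down i y => exact triv (.down i y) has rfl
      | up i y => exact triv (.up i y) has rfl
      | apex i y y' => exact triv (.apex i y y') has rfl

theorem Chain.exists_path (hgeod : IsGeodesicSpace X) {ε : ℝ} (hε : 0 ≤ ε) (n : ℕ) :
    ∀ {p q : PreElectrification Y} {a : ℝ}, Chain p q a → a ≤ (n + 1 : ℕ) * ε →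
      ∃ w : ℕ → PreElectrification Y, w 0 = p ∧ w (n + 1) = q ∧
        ∀ i < n + 1, dist (w i) (w (i + 1)) ≤ ε := by
  induction n with
  | zero =>
    intro p q a h ha
    refine ⟨fun i => if i = 0 then p else q, by simp, by simp, fun i hi => ?_⟩
    obtain rfl : i = 0 := by omega
    simpa using (dist_le_of_chain h).trans (by simpa using ha)
  | succ n ih =>
    intro p q a h ha
    push_cast at ha ih
    -- The minimum covers chains shorter than `ε`: what remains then has length zero.
    obtain ⟨r, h1, h2⟩ := h.split hgeod (min a ε) ⟨le_min h.nonneg hε, min_le_left _ _⟩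
    have hn : a - min a ε ≤ (n + 1) * ε := by
      have : 0 ≤ ((n : ℝ) + 1) * ε := by positivity
      rcases min_choice a ε with e | e <;> rw [e] <;> linarith
    obtain ⟨w, e0, e1, hw⟩ := ih h2 hn
    refine ⟨fun i => if i = 0 then p else w (i - 1), by simp, by simpa using e1, fun i hi => ?_⟩
    rcases Nat.eq_zero_or_pos i with rfl | hi'
    · simpa [e0] using (dist_le_of_chain h1).trans (min_le_right _ _)
    · obtain ⟨j, rfl⟩ : ∃ j, i = j + 1 := ⟨i - 1, by omega⟩
      simpa using hw j (by omega)

/-- Points at distance `d` are joined by a path of at most `5 * d + 2` steps of size `1 / 5`. -/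
theorem exists_path (hgeod : IsGeodesicSpace X) (p q : PreElectrification Y) :
    ∃ (n : ℕ) (w : ℕ → PreElectrification Y), (n : ℝ) ≤ 5 * dist p q + 2 ∧ w 0 = p ∧ w n = q ∧
      ∀ i < n, dist (w i) (w (i + 1)) ≤ 1 / 5 := by
  -- With this slack, `⌊5 * a⌋₊ + 1` steps are at most `5 * dist p q + 2`.
  obtain ⟨a, ha, c⟩ := exists_chain_lt (show dist p q < dist p q + 1 / 5 by linarith)
  have h1 := Nat.lt_floor_add_one (5 * a)
  have h2 := Nat.floor_le (show 0 ≤ 5 * a by linarith [c.nonneg])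
  obtain ⟨w, e0, e1, hw⟩ := c.exists_path hgeod (show (0 : ℝ) ≤ 1 / 5 by norm_num) ⌊5 * a⌋₊
    (by push_cast; linarith)
  exact ⟨_, w, by push_cast; linarith, e0, e1, hw⟩

theorem dist_path_le {w : ℕ → PreElectrification Y} {n : ℕ}
    (hw : ∀ i < n, dist (w i) (w (i + 1)) ≤ 1 / 5) {i j : ℕ} (hij : i ≤ j) (hj : j ≤ n) :
    dist (w i) (w j) ≤ ((j : ℝ) - i) / 5 := by
  induction j, hij using Nat.le_induction with
  | base => simp
  | succ k hk ih =>
    have := dist_triangle (w i) (w k) (w (k + 1))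
    have := hw k (by omega)
    have := ih (by omega)
    push_cast
    linarith

/-- The foot changes only under moves inside `X`, which pay for it, and under apex moves; climbing
from `p` to a first apex costs at least `1 / 2 - p.height`. -/
theorem Chain.dist_foot_le_or {p q : PreElectrification Y} {a : ℝ} (h : Chain p q a) :
    dist p.foot q.foot ≤ a ∨ 1 / 2 ≤ p.height + a := by
  induction h with
  | nil => simp
  | @cons p q r a b st ch ih =>
    have hb := ch.nonneg
    cases st with
    | base x y =>
      simp only [foot, height] at *
      have := dist_nonneg (x := x) (y := y)
      rcases ih with ih | ih
      · exact .inl ((dist_triangle x y r.foot).trans (add_le_add le_rfl ih))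
      · right; linarith
    | edge i y s t =>
      simp only [foot, height] at *
      have := neg_abs_le ((s : ℝ) - t)
      have := abs_nonneg ((s : ℝ) - t)
      rcases ih with ih | ih
      · left; linarith
      · right; linarith
    | down i y => simpa [foot, height] using ih
    | up i y => simpa [foot, height] using ih
    | apex i y y' =>
      right
      simp only [height]
      linarith

/-- Leaving the cone over `Y i` requires descending to height 0, at a cost of at least `t`. -/
theorem Chain.eq_edge {p q : PreElectrification Y} {a : ℝ} (h : Chain p q a) :
    ∀ (i : ι) (y : Y i) (t : Set.Icc (0 : ℝ) (1 / 2)), p = edge i y t → a < t →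
      ∃ (y' : Y i) (t' : Set.Icc (0 : ℝ) (1 / 2)), q = edge i y' t' := by
  induction h with
  | nil p =>
    intro i y t hp _
    exact ⟨y, t, hp⟩
  | @cons p q r a b st ch ih =>
    intro i y t hp hlt
    have hb := ch.nonneg
    cases st with
    | base x y => cases hp
    | edge j z s u =>
      cases hp
      have := le_abs_self ((t : ℝ) - u)
      exact ih i y u rfl (by linarith)
    | down j z =>
      cases hp
      simp at hlt
      linarith
    | up j z => cases hp
    | apex j z z' =>
      cases hp
      exact ih i z' _ rfl (by simpa using hlt)

/-! ### Quasiconvexity and Gromov products along paths. -/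

/-- The feet of two close points are close, or belong to the same member of the family. -/
theorem foot_close {p q : PreElectrification Y} (h : dist p q < 1 / 4) :
    dist p.foot q.foot ≤ 1 / 4 ∨ ∃ i, p.foot ∈ Y i ∧ q.foot ∈ Y i := by
  obtain ⟨a, ha, c⟩ := exists_chain_lt h
  rcases c.dist_foot_le_or with h | h
  · left; linarith
  · right
    cases p with
    | base x =>
      simp only [height] at h
      linarith
    | edge i y t =>
      simp only [height] at h
      -- Here `a < 1 / 4` and `1 / 2 ≤ t + a`, so `a < t`.
      obtain ⟨y', t', rfl⟩ := c.eq_edge i y t rfl (by linarith)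
      exact ⟨i, y.2, y'.2⟩

/-- Either the geodesic is short, or it is `Q`-close to some `Y i`, which has electrified diameter
at most 1. Using `max Q 0` allows for a negative `Q`, possible when every `Y i` is empty. -/
theorem dist_geodesic_foot_le {Q : ℝ} (hQ : ∀ i, IsQuasiconvex Q (Y i))
    {p q : PreElectrification Y} (h : dist p q < 1 / 4) {γ : ℝ → X}
    (hγ : IsGeodesicFromTo γ p.foot q.foot) {t : ℝ} (ht : t ∈ Set.Icc 0 (dist p.foot q.foot)) :
    dist (base (γ t) : PreElectrification Y) (base p.foot) ≤ max Q 0 + 1 := by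
  have hQ0 := le_max_right Q 0
  rcases foot_close h with h | ⟨i, hp, hq⟩
  · refine (dist_base_le _ _).trans ?_
    have := hγ.2.2 t ht 0 ⟨le_rfl, dist_nonneg⟩
    rw [hγ.1, sub_zero, abs_of_nonneg ht.1] at this
    linarith [ht.2]
  · obtain ⟨z, hz, hd⟩ := hQ i _ hp _ hq γ hγ t ht
    have a1 := dist_triangle (base (γ t) : PreElectrification Y) (base z) (base p.foot)
    have a2 := dist_base_le (Y := Y) (γ t) z
    have a3 := dist_base_le_one hz hp
    have := le_max_left Q 0
    linarith

/-- The geodesic between the feet has a point within `(p.foot | q.foot)_o + 2 * δ` of `o` in `X`, a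
fortiori in the electrification, and that point is electrically close to `p.foot`. -/
theorem le_gromovProduct_foot (hgeod : IsGeodesicSpace X) {δ : ℝ} (hδ : IsGromovHyperbolic X δ)
    {Q : ℝ} (hQ : ∀ i, IsQuasiconvex Q (Y i)) {p q : PreElectrification Y}
    (h : dist p q < 1 / 4) (o : X) :
    dist (base o) (base p.foot : PreElectrification Y) - (max Q 0 + 1 + 2 * δ) ≤
      gromovProduct o p.foot q.foot := by
  obtain ⟨γ, hγ⟩ := hgeod p.foot q.foot
  obtain ⟨t, ht, hd⟩ := hδ.exists_dist_geodesic_le hγ o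
  have a1 := dist_geodesic_foot_le hQ h hγ ht
  have a2 := dist_triangle (base o : PreElectrification Y) (base (γ t)) (base p.foot)
  have a3 := dist_base_le (Y := Y) o (γ t)
  linarith

/-- The Gromov product in `X` of the ends of a path of at most `2 ^ k` small steps is bounded below
in terms of `k` and of the distance from `o` to the path in the electrification. -/
theorem le_gromovProduct_path (hgeod : IsGeodesicSpace X) {δ : ℝ} (hδ : IsGromovHyperbolic X δ)
    {Q : ℝ} (hQ : ∀ i, IsQuasiconvex Q (Y i)) (o : X) (M : ℝ) {k n : ℕ} (hn : n ≤ 2 ^ k)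
    {w : ℕ → PreElectrification Y} (hw : ∀ i < n, dist (w i) (w (i + 1)) ≤ 1 / 5)
    (hM : ∀ i ≤ n, M ≤ dist (base o) (base (w i).foot : PreElectrification Y)) :
    M - (max Q 0 + 1 + 2 * δ) - k * δ ≤ gromovProduct o (w 0).foot (w n).foot := by
  have h0 := hδ.nonneg o
  rcases Nat.eq_zero_or_pos n with rfl | hpos
  · rw [gromovProduct_self]
    have a1 := hM 0 le_rfl
    have a2 := dist_base_le (Y := Y) o (w 0).foot
    have : 0 ≤ k * δ := by positivity
    have := le_max_right Q 0
    linarith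
  · refine hδ.le_gromovProduct_chain o _ k (fun i => (w i).foot) n hpos hn fun i hi => ?_
    have a1 := le_gromovProduct_foot hgeod hδ hQ
      (show dist (w i) (w (i + 1)) < 1 / 4 by linarith [hw i hi]) o
    have a2 := hM i hi.le
    linarith

/-! ### Geodesics of X seen in the electrification. -/

theorem continuousOn_base_geodesic {γ : ℝ → X} {x y : X} (hγ : IsGeodesicFromTo γ x y) :
    ContinuousOn (fun t => (base (γ t) : PreElectrification Y)) (Set.Icc 0 (dist x y)) := by
  refine LipschitzOnWith.continuousOn (K := 1) (LipschitzOnWith.of_dist_le_mul ?_)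
  intro s hs t ht
  simpa [hγ.2.2 s hs t ht, Real.dist_eq] using dist_base_le (Y := Y) (γ s) (γ t)

/-- If the points of a geodesic of `X` are `D + 1`-close to `V` in the electrification and `γ r`
is almost as far as possible from `V`, then some point of the geodesic, on the side of a given
`γ s₀ ∈ V`, is close to `γ r` and has a large Gromov product with a point of `V`. -/
theorem exists_gromovProduct_ge (hgeod : IsGeodesicSpace X) {δ : ℝ} (hδ : IsGromovHyperbolic X δ)
    {Q : ℝ} (hQ : ∀ i, IsQuasiconvex Q (Y i)) {γ : ℝ → X} {x y : X}
    (hγ : IsGeodesicFromTo γ x y) {D : ℝ} (hD : 0 ≤ D) {k : ℕ} (hk : 5 * D + 7 ≤ 2 ^ k)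
    {V : Set X}
    (hV : ∀ t ∈ Set.Icc 0 (dist x y), ∃ v ∈ V,
      dist (base (γ t) : PreElectrification Y) (base v) ≤ D + 1)
    {r : ℝ} (hr : r ∈ Set.Icc 0 (dist x y))
    (hrV : ∀ v ∈ V, D - 1 ≤ dist (base (γ r) : PreElectrification Y) (base v))
    {s₀ : ℝ} (hs₀ : s₀ ∈ Set.Icc 0 (dist x y)) (hs₀V : γ s₀ ∈ V) :
    ∃ s ∈ Set.uIcc s₀ r, ∃ v ∈ V,
      dist (base (γ r) : PreElectrification Y) (base (γ s)) ≤ 2 * D + 2 ∧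
      dist (base (γ s) : PreElectrification Y) (base v) ≤ D + 1 ∧
      D - 1 - (max Q 0 + 1 + 2 * δ) - k * δ ≤ gromovProduct (γ r) (γ s) v := by
  have h0 := hδ.nonneg x
  have hQ0 := le_max_right Q 0
  have hkδ : 0 ≤ k * δ := by positivity
  rcases le_total (dist (base (γ s₀) : PreElectrification Y) (base (γ r))) (2 * D + 2) with h | h
  · refine ⟨s₀, Set.left_mem_uIcc, γ s₀, hs₀V, by rwa [dist_comm], by simp; linarith, ?_⟩
    rw [gromovProduct_self]
    have a1 := hrV _ hs₀V
    have a2 := dist_base_le (Y := Y) (γ r) (γ s₀)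
    linarith
  · have hc : ContinuousOn (fun t => dist (base (γ t) : PreElectrification Y) (base (γ r)))
        (Set.uIcc s₀ r) :=
      (continuous_id.dist continuous_const).comp_continuousOn
        ((continuousOn_base_geodesic hγ).mono (Set.uIcc_subset_Icc hs₀ hr))
    -- At distance `2 * D + 2` from `γ r`, a path of at most `5 * D + 7` steps from `γ s` to `V`,
    -- with its feet, remains at distance at least `D - 1` from `γ r`.
    obtain ⟨s, hs, hsd⟩ := intermediate_value_uIcc hc
      (Set.mem_uIcc.2 (.inr ⟨by simp; linarith, h⟩) : 2 * D + 2 ∈ _)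
    have hsI := Set.uIcc_subset_Icc hs₀ hr hs
    obtain ⟨v, hv, hvd⟩ := hV s hsI
    refine ⟨s, hs, v, hv, by rw [dist_comm]; exact hsd.le, hvd, ?_⟩
    obtain ⟨n, w, hn, e0, e1, hw⟩ :=
      exists_path hgeod (base (γ s) : PreElectrification Y) (base v)
    have hnk : n ≤ 2 ^ k := by
      have : (n : ℝ) ≤ 2 ^ k := by linarith
      exact_mod_cast this
    have key := le_gromovProduct_path hgeod hδ hQ (γ r) (D - 1) hnk hw fun i hi => ?_
    · simpa only [e0, e1, foot] using key
    · have a1 := dist_path_le hw (Nat.zero_le i) hi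
      have a2 := dist_foot_le (w i)
      have a4 : (i : ℝ) ≤ n := by exact_mod_cast hi
      have a5 := dist_triangle (base (γ s)) (w i) (base (w i).foot)
      have a6 := dist_triangle_right (base (γ s)) (base (γ r))
        (base (w i).foot : PreElectrification Y)
      simp only [e0, Nat.cast_zero, sub_zero] at *
      linarith

/-- In the electrification, a geodesic of `X` passes close to every almost shortest path
between its ends. -/
theorem exists_dist_path_le (hgeod : IsGeodesicSpace X) {δ : ℝ} (hδ : IsGromovHyperbolic X δ)
    {Q : ℝ} (hQ : ∀ i, IsQuasiconvex Q (Y i)) :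
    ∃ D₀ : ℝ, ∀ (γ : ℝ → X) (x y : X), IsGeodesicFromTo γ x y →
      ∀ (n : ℕ) (w : ℕ → PreElectrification Y),
        (n : ℝ) ≤ 5 * dist (base x : PreElectrification Y) (base y) + 2 →
        w 0 = base x → w n = base y → (∀ i < n, dist (w i) (w (i + 1)) ≤ 1 / 5) →
        ∀ t ∈ Set.Icc 0 (dist x y), ∃ i ≤ n,
          dist (base (γ t) : PreElectrification Y) (base (w i).foot) ≤ D₀ + 1 := by
  -- `30 * D + 37 = 5 * (6 * D + 7) + 2` bounds the number of steps of `w` between the two points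
  -- reached from either side of `γ r`; the final `2 * δ` pays for joining the three pieces of the
  -- detour.
  obtain ⟨D₀, hD₀⟩ := exists_bound_of_le_add_log (1 + (max Q 0 + 1 + 2 * δ) + 2 * δ) δ 30 37
  refine ⟨D₀, fun γ x y hγ n w hn e0 e1 hw => ?_⟩
  have h0 := hδ.nonneg x
  -- Its supremum `D` measures how far the geodesic strays from the feet of the path. It need not be
  -- attained, whence the slack of 1 in `hnear` and in the choice of `r`.
  let S : Set ℝ := {r | ∃ t ∈ Set.Icc 0 (dist x y), ∀ i ≤ n,
    r ≤ dist (base (γ t) : PreElectrification Y) (base (w i).foot)}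
  have hI0 : (0 : ℝ) ∈ Set.Icc 0 (dist x y) := ⟨le_rfl, dist_nonneg⟩
  have hI1 : dist x y ∈ Set.Icc 0 (dist x y) := ⟨dist_nonneg, le_rfl⟩
  have hmem : (0 : ℝ) ∈ S := ⟨0, hI0, fun i _ => dist_nonneg⟩
  have hbdd : BddAbove S := by
    refine ⟨dist x y, ?_⟩
    rintro r ⟨t, ht, h⟩
    refine (h 0 (Nat.zero_le _)).trans ((dist_base_le _ _).trans ?_)
    have := hγ.2.2 t ht 0 hI0
    rw [hγ.1, sub_zero, abs_of_nonneg ht.1] at this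
    simpa only [e0, foot, this] using ht.2
  set D := sSup S
  have hDnn : 0 ≤ D := le_csSup hbdd hmem
  have hnear : ∀ t ∈ Set.Icc 0 (dist x y), ∃ i ≤ n,
      dist (base (γ t) : PreElectrification Y) (base (w i).foot) ≤ D + 1 := by
    intro t ht
    by_contra! hcon
    have : D + 1 ≤ D := le_csSup hbdd ⟨t, ht, fun i hi => (hcon i hi).le⟩
    linarith
  suffices hDD : D ≤ D₀ by
    intro t ht
    obtain ⟨i, hi, h⟩ := hnear t ht
    exact ⟨i, hi, by linarith⟩
  obtain ⟨ρ, ⟨r, hr, hrS⟩, hρ⟩ := exists_lt_of_lt_csSup ⟨0, hmem⟩ (show D - 1 < sSup S by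
    change D - 1 < D; linarith)
  refine hD₀ D (fun k hk => ?_) (by norm_num) h0
  let V : Set X := {v | ∃ i ≤ n, v = (w i).foot}
  have hV : ∀ t ∈ Set.Icc 0 (dist x y), ∃ v ∈ V,
      dist (base (γ t) : PreElectrification Y) (base v) ≤ D + 1 := fun t ht => by
    obtain ⟨i, hi, h⟩ := hnear t ht
    exact ⟨_, ⟨i, hi, rfl⟩, h⟩
  have hrV : ∀ v ∈ V, D - 1 ≤ dist (base (γ r) : PreElectrification Y) (base v) := by
    rintro v ⟨i, hi, rfl⟩
    linarith [hrS i hi]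
  obtain ⟨s, hs, _, ⟨i, hi, rfl⟩, hs1, hs2, hs3⟩ := exists_gromovProduct_ge hgeod hδ hQ hγ hDnn
    (show 5 * D + 7 ≤ 2 ^ k by linarith) hV hr hrV hI0 ⟨0, Nat.zero_le _, by rw [hγ.1, e0, foot]⟩
  obtain ⟨t, ht, _, ⟨j, hj, rfl⟩, ht1, ht2, ht3⟩ := exists_gromovProduct_ge hgeod hδ hQ hγ hDnn
    (show 5 * D + 7 ≤ 2 ^ k by linarith) hV hr hrV hI1 ⟨n, le_rfl, by rw [hγ.2.1, e1, foot]⟩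
  rw [Set.uIcc_of_le hr.1] at hs
  rw [Set.uIcc_of_ge hr.2] at ht
  -- As `w` is almost shortest, a portion with ends at distance at most `6 * D + 7` has at most `30
  -- * D + 37` steps.
  have hmid : ∀ i j, i ≤ j → j ≤ n → dist (w i) (w j) ≤ 6 * D + 7 →
      D - 1 - (max Q 0 + 1 + 2 * δ) - k * δ ≤ gromovProduct (γ r) (w i).foot (w j).foot := by
    intro i j hij hj hd
    have b1 := dist_path_le hw (Nat.zero_le i) (hij.trans hj)
    have b2 := dist_path_le hw hj le_rfl
    have b3 := dist_triangle4 (w 0) (w i) (w j) (w n)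
    rw [e0, e1] at b3
    rw [e0] at b1
    rw [e1] at b2
    obtain ⟨m, rfl⟩ := Nat.exists_eq_add_of_le hij
    have hmk : m ≤ 2 ^ k := by
      have : (m : ℝ) ≤ 2 ^ k := by
        push_cast at *
        linarith
      exact_mod_cast this
    exact le_gromovProduct_path hgeod hδ hQ (γ r) (D - 1) hmk (w := fun l => w (i + l))
      (fun l hl => hw (i + l) (by omega)) fun l hl => hrV _ ⟨i + l, by omega, rfl⟩
  have hd : dist (w i) (w j) ≤ 6 * D + 7 := by
    have c1 := dist_triangle4 (w i) (base (w i).foot) (base (w j).foot) (w j)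
    have c2 := dist_foot_le (w i)
    have c3 := dist_foot_le (w j)
    have c4 := dist_triangle4 (base (w i).foot) (base (γ s)) (base (γ t))
      (base (w j).foot : PreElectrification Y)
    have c5 := dist_triangle_left (base (γ s)) (base (γ t)) (base (γ r) : PreElectrification Y)
    rw [dist_comm (w j)] at c3
    rw [dist_comm (base (γ s))] at hs2
    linarith
  have hm : D - 1 - (max Q 0 + 1 + 2 * δ) - k * δ ≤
      gromovProduct (γ r) (w i).foot (w j).foot := by
    rcases le_total i j with hij | hij
    · exact hmid i j hij hj hd
    · rw [gromovProduct_comm]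
      exact hmid j i hij hi (by rwa [dist_comm])
  -- The two ends of the detour lie on the geodesic on either side of `γ r`, so this zero is bounded
  -- below by `D` minus a logarithmic term.
  have hz := hγ.gromovProduct_eq_zero hr hs ht
  have q1 := hδ (γ r) (γ s) (w i).foot (w j).foot
  have q2 := hδ (γ r) (γ s) (w j).foot (γ t)
  rw [gromovProduct_comm] at ht3
  have q3 := le_min hs3 hm
  have q4 := le_min (show D - 1 - (max Q 0 + 1 + 2 * δ) - k * δ - δ ≤
    gromovProduct (γ r) (γ s) (w j).foot by linarith)
    (show D - 1 - (max Q 0 + 1 + 2 * δ) - k * δ - δ ≤ gromovProduct (γ r) (w j).foot (γ t) by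
      linarith)
  linarith

/-- Geodesics of `X` satisfy a reverse triangle inequality in the electrification. -/
theorem exists_dist_add_dist_geodesic_le (hgeod : IsGeodesicSpace X) {δ : ℝ}
    (hδ : IsGromovHyperbolic X δ) {Q : ℝ} (hQ : ∀ i, IsQuasiconvex Q (Y i)) :
    ∃ K : ℝ, ∀ (γ : ℝ → X) (x y : X), IsGeodesicFromTo γ x y → ∀ t ∈ Set.Icc 0 (dist x y),
      dist (base x : PreElectrification Y) (base (γ t)) +
          dist (base (γ t) : PreElectrification Y) (base y) ≤
        dist (base x : PreElectrification Y) (base y) + K := by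
  obtain ⟨D₀, hD₀⟩ := exists_dist_path_le hgeod hδ hQ
  -- Both distances are estimated by following `w` and then crossing to `γ t`: two crossings, two
  -- feet at `1 / 2`, and the excess `2 / 5` of `n / 5`.
  refine ⟨2 * (D₀ + 1) + 2, fun γ x y hγ t ht => ?_⟩
  obtain ⟨n, w, hn, e0, e1, hw⟩ := exists_path hgeod (base x : PreElectrification Y) (base y)
  obtain ⟨i, hi, h⟩ := hD₀ γ x y hγ n w hn e0 e1 hw t ht
  have b1 := dist_path_le hw (Nat.zero_le i) hi
  have b2 := dist_path_le hw hi le_rfl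
  have c2 := dist_foot_le (w i)
  have d1 := dist_triangle4 (base x) (w i) (base (w i).foot) (base (γ t))
  have d2 := dist_triangle4 (base (γ t)) (base (w i).foot) (w i) (base y)
  rw [dist_comm (base (w i).foot) (base (γ t))] at d1
  rw [dist_comm _ (w i)] at d2
  simp only [e0, e1, Nat.cast_zero] at b1 b2
  linarith

/-- The Gromov product of the electrification is bounded by that of `X`. -/
theorem exists_gromovProduct_le (hgeod : IsGeodesicSpace X) {δ : ℝ}
    (hδ : IsGromovHyperbolic X δ) {Q : ℝ} (hQ : ∀ i, IsQuasiconvex Q (Y i)) :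
    ∃ C : ℝ, ∀ o a b : X,
      gromovProduct (SeparationQuotient.mk (base o) : Electrification Y)
        (SeparationQuotient.mk (base a)) (SeparationQuotient.mk (base b)) ≤
        gromovProduct o a b + C := by
  obtain ⟨K, hK⟩ := exists_dist_add_dist_geodesic_le hgeod hδ hQ
  -- In the electrification, the product of `a` and `b` at `o` is at most the distance from `o` to
  -- `γ t` plus `K / 2`.
  refine ⟨2 * δ + K / 2, fun o a b => ?_⟩
  obtain ⟨γ, hγ⟩ := hgeod a b
  obtain ⟨t, ht, hd⟩ := hδ.exists_dist_geodesic_le hγ o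
  have a1 := hK γ a b hγ t ht
  have a2 := dist_triangle_right (base o : PreElectrification Y) (base a) (base (γ t))
  have a3 := dist_triangle (base o : PreElectrification Y) (base (γ t)) (base b)
  have a4 := dist_base_le (Y := Y) o (γ t)
  have : gromovProduct (SeparationQuotient.mk (base o) : Electrification Y)
        (SeparationQuotient.mk (base a)) (SeparationQuotient.mk (base b)) =
      (dist (base o : PreElectrification Y) (base a) + dist (base o : PreElectrification Y) (base b)
        - dist (base a : PreElectrification Y) (base b)) / 2 := rfl
  rw [this]
  linarith

end PreElectrification

/-! ### The equivariant map between boundaries. -/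

namespace Electrification

variable {X : Type*} [MetricSpace X] {ι : Type*} {Y : ι → Set X}

/-- The inclusion of `X` in its electrification. -/
noncomputable def of (Y : ι → Set X) (x : X) : Electrification Y := SeparationQuotient.mk (.base x)

theorem exists_dist_of_le (z : Electrification Y) : ∃ x : X, dist z (of Y x) ≤ 1 / 2 := by
  obtain ⟨p, rfl⟩ := SeparationQuotient.surjective_mk z
  exact ⟨p.foot, PreElectrification.dist_foot_le p⟩

/-- A point of `X` at distance at most `1 / 2`. -/
noncomputable def proj (z : Electrification Y) : X := (exists_dist_of_le z).choose

theorem dist_proj_le (z : Electrification Y) : dist z (of Y (proj z)) ≤ 1 / 2 :=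
  (exists_dist_of_le z).choose_spec

/-- Asymptotic sequences of the electrification stay at bounded distance from asymptotic sequences
of `X`. -/
theorem gromovAsymptotic_of_dist_le (hgeod : IsGeodesicSpace X) {δ : ℝ}
    (hδ : IsGromovHyperbolic X δ) {Q : ℝ} (hQ : ∀ i, IsQuasiconvex Q (Y i))
    {u v : ℕ → Electrification Y} (h : GromovAsymptotic u v) {u' v' : ℕ → X}
    (hu : ∀ n, dist (u n) (of Y (u' n)) ≤ 1 / 2) (hv : ∀ n, dist (v n) (of Y (v' n)) ≤ 1 / 2) :
    GromovAsymptotic u' v' := by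
  obtain ⟨C, hC⟩ := PreElectrification.exists_gromovProduct_le hgeod hδ hQ
  intro o
  -- Moving both points by `1 / 2` changes the Gromov product by at most 1.
  refine tendsto_atTop_mono (fun p => ?_) (tendsto_atTop_add_const_right _ (-(1 + C)) (h (of Y o)))
  have a0 := hC o (u' p.1) (v' p.2)
  change gromovProduct (of Y o) (of Y (u' p.1)) (of Y (v' p.2)) ≤ _ at a0
  have a1 := hu p.1
  have a2 := hv p.2
  have a3 := dist_triangle_right (of Y o) (u p.1) (of Y (u' p.1))
  have a4 := dist_triangle_right (of Y o) (v p.2) (of Y (v' p.2))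
  have a5 := dist_triangle4_left (u p.1) (of Y (u' p.1)) (of Y (v' p.2)) (v p.2)
  have a6 := dist_triangle4 (of Y (u' p.1)) (u p.1) (v p.2) (of Y (v' p.2))
  rw [dist_comm _ (u p.1)] at a6
  simp only [gromovProduct] at *
  linarith

/-- The map from the boundary of the electrification to the boundary of `X`. -/
noncomputable def boundaryProj (hgeod : IsGeodesicSpace X) {δ : ℝ}
    (hδ : IsGromovHyperbolic X δ) {Q : ℝ} (hQ : ∀ i, IsQuasiconvex Q (Y i)) :
    GromovBoundary (Electrification Y) → GromovBoundary X :=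
  Quot.map
    (fun u => ⟨fun n => proj (u.1 n), gromovAsymptotic_of_dist_le hgeod hδ hQ u.2
      (fun _ => dist_proj_le _) (fun _ => dist_proj_le _)⟩)
    (fun _ _ h => gromovAsymptotic_of_dist_le hgeod hδ hQ h
      (fun _ => dist_proj_le _) (fun _ => dist_proj_le _))

/-- The choice made by `proj` need not commute with `f`, but applying `f` before or after it gives
points of `X` that are both `1 / 2`-close to the same point of the electrification, hence asymptotic
sequences. -/
theorem boundaryMap_boundaryProj (hgeod : IsGeodesicSpace X) {δ : ℝ}
    (hδ : IsGromovHyperbolic X δ) {Q : ℝ} (hQ : ∀ i, IsQuasiconvex Q (Y i)) (f : X ≃ᵢ X)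
    (σ : Equiv.Perm ι) (hf : ∀ i, f '' Y i = Y (σ i)) (ξ : GromovBoundary (Electrification Y)) :
    boundaryMap f (boundaryProj hgeod hδ hQ ξ) =
      boundaryProj hgeod hδ hQ (boundaryMap (electrificationIsometry f σ hf) ξ) := by
  induction ξ using Quot.ind with
  | mk u =>
    refine Quot.sound (gromovAsymptotic_of_dist_le hgeod hδ hQ
      (u.2.map (electrificationIsometry f σ hf)) (fun n => ?_) (fun _ => dist_proj_le _))
    change dist _ (electrificationIsometry f σ hf (of Y (proj (u.1 n)))) ≤ _
    rw [(electrificationIsometry f σ hf).dist_eq]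
    exact dist_proj_le _

end Electrification

theorem mainTheorem11 {X : Type*} [MetricSpace X] (hgeod : IsGeodesicSpace X)
    (δ : ℝ) (hδ : IsGromovHyperbolic X δ)
    {ι : Type*} (Y : ι → Set X) (Q : ℝ) (hQ : ∀ i, IsQuasiconvex Q (Y i))
    (f g : X ≃ᵢ X) (σ τ : Equiv.Perm ι)
    (hf : ∀ i, f '' Y i = Y (σ i)) (hg : ∀ i, g '' Y i = Y (τ i))
    (hf_lox : IsLoxodromic (electrificationIsometry f σ hf))
    (hg_lox : IsLoxodromic (electrificationIsometry g τ hg))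
    (hind : AreIndependentLoxodromics f g) :
    AreIndependentLoxodromics (electrificationIsometry f σ hf)
      (electrificationIsometry g τ hg) := by
  refine ⟨hf_lox, hg_lox, Set.disjoint_left.2 fun ξ hξf hξg => ?_⟩
  have h₁ : Electrification.boundaryProj hgeod hδ hQ ξ ∈ Function.fixedPoints (boundaryMap f) := by
    rw [Function.mem_fixedPoints, Function.IsFixedPt,
      Electrification.boundaryMap_boundaryProj hgeod hδ hQ f σ hf, hξf]
  have h₂ : Electrification.boundaryProj hgeod hδ hQ ξ ∈ Function.fixedPoints (boundaryMap g) := by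
    rw [Function.mem_fixedPoints, Function.IsFixedPt,
      Electrification.boundaryMap_boundaryProj hgeod hδ hQ g τ hg, hξg]
  exact Set.disjoint_left.1 hind.2.2 h₁ h₂
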